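/- For a constant $c>0$, call a metric space $(X,d)$ *$c$-monotone* if there is a linear order $<$ on $X$ such that $d(x,y)\le c\,d(x,z)$ for all $x,y,z\in X$ with $x<y<z$. The graph of a function $g:[0,1]\to\mathbb{R}$ is the set $\{(x,g(x)):x\in[0,1]\}\subset\mathbb{R}^2$ with the Euclidean metric. Let $f:[0,1]\to\mathbb{R}$ be continuous. Then $f$ is of bounded variation if and only if there are continuous functions $g,h:[0,1]\to\mathbb{R}$, both with $1$-monotone graphs, such that $f=g+h$. -/

import Mathlib

/-- A metric space `X` is `c`-monotone if there is some linear order on `X` such that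
`d(x, y) ≤ c * d(x, z)` whenever `x < y < z`. No compatibility of the order with the topology
is required. -/
def IsCMonotoneSpace (c : ℝ) (X : Type*) [MetricSpace X] : Prop :=
  ∃ _ : LinearOrder X, ∀ x y z : X, x < y → y < z → dist x y ≤ c * dist x z

/-- The graph of a real function `f` on a set `s` of reals, as a subset of the Euclidean plane. -/
def planeGraph {s : Set ℝ} (f : s → ℝ) : Set (EuclideanSpace ℝ (Fin 2)) :=
  Set.range fun x : s => !₂[(x : ℝ), f x]

/-- The graph of `f`, with the Euclidean metric of the plane, is a `c`-monotone metric space. -/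
def HasCMonotoneGraph (c : ℝ) {s : Set ℝ} (f : s → ℝ) : Prop :=
  IsCMonotoneSpace c (planeGraph f)

open Set Filter Topology

/-! Forward: the Jordan decomposition `f = v - (v - f)`, with `v` the variation function, which is
continuous because `f` is; a monotone function and its negative have 1-monotone graphs. Backward:
the order on a 1-monotone graph has metrically open rays, so it must be the left-to-right order or
its reverse. After a possible reflection, distances from each graph point grow to the right. Then
every steep climb of `g` forces a comparable rise of the bounded running supremum of `g x + x`;
descents are climbs of `-g`. Hence `g` has a monotone majorant, and majorants add. -/

/-! ### Functions whose increments are dominated by those of a monotone function -/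

/-- The increments of `f` are bounded by those of some monotone function. -/
def HasMonotoneMajorant {α : Type*} [Preorder α] (f : α → ℝ) : Prop :=
  ∃ φ : α → ℝ, Monotone φ ∧ ∀ ⦃x y⦄, x ≤ y → |f y - f x| ≤ φ y - φ x

theorem HasMonotoneMajorant.add {α : Type*} [Preorder α] {f g : α → ℝ}
    (hf : HasMonotoneMajorant f) (hg : HasMonotoneMajorant g) :
    HasMonotoneMajorant fun x => f x + g x := by
  obtain ⟨φ, hφ, hfφ⟩ := hf
  obtain ⟨ψ, hψ, hgψ⟩ := hg
  refine ⟨fun x => φ x + ψ x, hφ.add hψ, fun x y hxy => ?_⟩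
  calc |f y + g y - (f x + g x)| = |(f y - f x) + (g y - g x)| := by ring_nf
    _ ≤ |f y - f x| + |g y - g x| := abs_add_le _ _
    _ ≤ φ y + ψ y - (φ x + ψ x) := by linarith [hfφ hxy, hgψ hxy]

theorem HasMonotoneMajorant.comp_antitone {α β : Type*} [Preorder α] [Preorder β] {f : α → ℝ}
    (hf : HasMonotoneMajorant f) {σ : β → α} (hσ : Antitone σ) :
    HasMonotoneMajorant (f ∘ σ) := by
  obtain ⟨φ, hφ, hfφ⟩ := hf
  refine ⟨fun x => -φ (σ x), fun x y hxy => neg_le_neg (hφ (hσ hxy)), fun x y hxy => ?_⟩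
  have := hfφ (hσ hxy)
  rw [abs_sub_comm] at this
  simp only [Function.comp_apply]
  linarith

theorem HasMonotoneMajorant.boundedVariationOn {α : Type*} [LinearOrder α] [BoundedOrder α]
    {f : α → ℝ} (hf : HasMonotoneMajorant f) : BoundedVariationOn f univ := by
  obtain ⟨φ, hφ, hfφ⟩ := hf
  have hle : eVariationOn f univ ≤ eVariationOn φ univ := by
    refine iSup_mono fun p => Finset.sum_le_sum fun i _ => ?_
    have hi : p.2.1 i ≤ p.2.1 (i + 1) := p.2.2.1 (Nat.le_succ i)
    rw [edist_dist, edist_dist, Real.dist_eq, Real.dist_eq]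
    exact ENNReal.ofReal_le_ofReal ((hfφ hi).trans (le_abs_self _))
  have hb : BoundedVariationOn φ univ :=
    (hφ.monotoneOn univ).boundedVariationOn (C := max |φ ⊥| |φ ⊤|)
      fun x _ => abs_le_max_abs_abs (hφ bot_le) (hφ le_top)
  exact ne_top_of_le_ne_top hb hle

/-! ### Functions whose graph recedes from each of its points -/

/-- The supremum of `f` over the points up to `t`. -/
noncomputable def runningSup {α : Type*} [Preorder α] (f : α → ℝ) (t : α) : ℝ :=
  sSup (f '' Iic t)

theorem monotone_runningSup {α : Type*} [Preorder α] {f : α → ℝ} (hf : BddAbove (range f)) :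
    Monotone (runningSup f) := fun _ y hxy =>
  csSup_le_csSup (hf.mono (image_subset_range f (Iic y))) (nonempty_Iic.image f)
    (image_mono (Iic_subset_Iic.2 hxy))

theorem le_runningSup {α : Type*} [Preorder α] {f : α → ℝ} (hf : BddAbove (range f)) (t : α) :
    f t ≤ runningSup f t :=
  le_csSup (hf.mono (image_subset_range f _)) (mem_image_of_mem f (mem_Iic.2 le_rfl))

theorem runningSup_le {α : Type*} [Preorder α] {f : α → ℝ} {t : α} {a : ℝ}
    (h : ∀ x ≤ t, f x ≤ a) : runningSup f t ≤ a :=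
  csSup_le (nonempty_Iic.image f) (forall_mem_image.2 h)

/-- The points of the graph of `g` move away, from left to right, from each earlier point. -/
def GraphRecedes {s : Set ℝ} (g : s → ℝ) : Prop :=
  ∀ ⦃x y z : s⦄, x < y → y < z →
    ((x : ℝ) - y) ^ 2 + (g x - g y) ^ 2 ≤ ((x : ℝ) - z) ^ 2 + (g x - g z) ^ 2

theorem GraphRecedes.neg {s : Set ℝ} {g : s → ℝ} (hg : GraphRecedes g) :
    GraphRecedes fun x => -g x := fun x y z hxy hyz => by
  have := hg hxy hyz
  nlinarith

/-- A steep climb strictly raises the running supremum of `g x + x`: the perpendicular bisector of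
the climb leaves all earlier points on the lower side. -/
theorem GraphRecedes.sub_le {s : Set ℝ} {g : s → ℝ} (hg : GraphRecedes g)
    (hb : BddAbove (range fun x : s => g x + x)) {y z : s} (hyz : y ≤ z) :
    g z - g y ≤ 2 * ((z : ℝ) - y) +
      4 * (runningSup (fun x : s => g x + x) z - runningSup (fun x : s => g x + x) y) := by
  have hmono := monotone_runningSup hb hyz
  have hyz' : (y : ℝ) ≤ z := hyz
  by_cases hsteep : g z - g y ≤ 2 * ((z : ℝ) - y)
  · linarith
  push Not at hsteep
  have hlt : y < z := lt_of_le_of_ne hyz fun h => by simp [h] at hsteep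
  have hup : runningSup (fun x : s => g x + x) y ≤ g y + y + 5 / 8 * (g z - g y) := by
    refine runningSup_le fun x hxy => ?_
    rcases hxy.eq_or_lt with rfl | hxy
    · linarith
    have h := hg hxy hlt
    have hxy' : (x : ℝ) < y := hxy
    -- Expanding `h` gives `2qb ≤ 2pa + a² + b²`; with `a < b/2` this yields `q ≤ p/2 + 5b/8`, the
    -- source of `5/8`. The rise of the supremum is then at least `3b/8`, which the factor 4
    -- absorbs.
    obtain ⟨a, ha⟩ : ∃ a, a = (z : ℝ) - y := ⟨_, rfl⟩
    obtain ⟨b, hb⟩ : ∃ b, b = g z - g y := ⟨_, rfl⟩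
    obtain ⟨p, hp⟩ : ∃ p, p = (y : ℝ) - x := ⟨_, rfl⟩
    obtain ⟨q, hq⟩ : ∃ q, q = g x - g y := ⟨_, rfl⟩
    have h' : 2 * (q * b) ≤ 2 * (p * a) + a ^ 2 + b ^ 2 := by
      subst ha hb hp hq
      nlinarith
    have hab : 2 * a < b := by linarith
    have ha0 : 0 ≤ a := by linarith
    have hp0 : 0 < p := by linarith
    have key : (q - p - 5 / 8 * b) * b ≤ 0 := by nlinarith
    have : q - p - 5 / 8 * b ≤ 0 := nonpos_of_mul_nonpos_left key (by linarith)
    linarith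
  have hz : g z + z ≤ runningSup (fun x : s => g x + x) z := le_runningSup hb z
  linarith

theorem GraphRecedes.hasMonotoneMajorant {s : Set ℝ} [CompactSpace s] {g : s → ℝ}
    (hg : GraphRecedes g) (hc : Continuous g) : HasMonotoneMajorant g := by
  have hb₁ : BddAbove (range fun x : s => g x + x) :=
    (isCompact_range (hc.add continuous_subtype_val)).bddAbove
  have hb₂ : BddAbove (range fun x : s => -g x + x) :=
    (isCompact_range (hc.neg.add continuous_subtype_val)).bddAbove
  have hm₁ := monotone_runningSup hb₁
  have hm₂ := monotone_runningSup hb₂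
  refine ⟨fun x => 2 * (x : ℝ) + 4 * runningSup (fun x : s => g x + x) x +
    4 * runningSup (fun x : s => -g x + x) x, fun x y hxy => ?_, fun x y hxy => ?_⟩
  · have h : (x : ℝ) ≤ y := hxy
    linarith [hm₁ hxy, hm₂ hxy]
  · have h₁ := hg.sub_le hb₁ hxy
    have h₂ := hg.neg.sub_le hb₂ hxy
    rw [abs_le]
    constructor <;> linarith [hm₁ hxy, hm₂ hxy]

/-! ### The order of a monotone space -/

/-- If distances to a point increase along a linear order, the open rays of that order are open. -/
theorem isOpen_rays_of_dist_le {X : Type*} [MetricSpace X] [LinearOrder X]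
    (h : ∀ x y z : X, x < y → y < z → dist x y ≤ dist x z) (a : X) :
    IsOpen (Ioi a) ∧ IsOpen (Iio a) := by
  refine ⟨Metric.isOpen_iff.2 fun y hy => ⟨dist a y / 2, ?_, fun w hw => ?_⟩,
    Metric.isOpen_iff.2 fun y hy => ⟨dist y a, dist_pos.2 (ne_of_lt hy), fun w hw => ?_⟩⟩
  · exact half_pos (dist_pos.2 (ne_of_lt hy))
  -- If `w < a < y`, then `dist w a ≤ dist w y`, so `dist a y ≤ 2 * dist w y`: hence the halved
  -- radius.
  · by_contra hwa
    rw [Metric.mem_ball] at hw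
    rcases (not_lt.1 hwa).eq_or_lt with rfl | hwa
    · linarith [dist_nonneg (x := w) (y := y)]
    · linarith [h w a y hwa hy, dist_triangle_left a y w]
  · by_contra hwa
    rw [Metric.mem_ball, dist_comm] at hw
    rcases (not_lt.1 hwa).eq_or_lt with rfl | hwa
    · exact lt_irrefl _ hw
    · linarith [h y a w hy hwa]

theorem strictMono_or_strictAnti_of_dist_le {α X : Type*} [CompleteLinearOrder α]
    [TopologicalSpace α] [OrderTopology α] [DenselyOrdered α] [MetricSpace X] [LinearOrder X]
    (h : ∀ x y z : X, x < y → y < z → dist x y ≤ dist x z) {p : α → X} (hp : Continuous p)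
    (hinj : Function.Injective p) : StrictMono p ∨ StrictAnti p := by
  -- Open rays make the order topology coarser than the metric one, so `p` stays continuous and the
  -- intermediate value argument applies.
  have hc : Continuous[_, Preorder.topology X] p := by
    refine continuous_generateFrom_iff.2 ?_
    rintro s ⟨a, rfl | rfl⟩
    · exact (isOpen_rays_of_dist_le h a).1.preimage hp
    · exact (isOpen_rays_of_dist_le h a).2.preimage hp
  exact @Continuous.strictMono_of_inj_boundedOrder' α _ _ _ _ X _ (Preorder.topology X)
    (@OrderTopology.to_orderClosedTopology X (Preorder.topology X) _
      (@OrderTopology.mk X (Preorder.topology X) _ rfl)) _ p hc hinj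

/-! ### Graphs of functions -/

/-- The point of the graph of `g` over `x`. -/
def graphPoint {s : Set ℝ} (g : s → ℝ) (x : s) : planeGraph g :=
  ⟨!₂[(x : ℝ), g x], mem_range_self x⟩

theorem dist_graphPoint {s : Set ℝ} (g : s → ℝ) (x y : s) :
    dist (graphPoint g x) (graphPoint g y) = √(((x : ℝ) - y) ^ 2 + (g x - g y) ^ 2) := by
  simp [graphPoint, Subtype.dist_eq, EuclideanSpace.dist_eq, Real.dist_eq, sq_abs]

theorem dist_graphPoint_le_iff {s : Set ℝ} (g : s → ℝ) (x y z : s) :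
    dist (graphPoint g x) (graphPoint g y) ≤ dist (graphPoint g x) (graphPoint g z) ↔
      ((x : ℝ) - y) ^ 2 + (g x - g y) ^ 2 ≤ ((x : ℝ) - z) ^ 2 + (g x - g z) ^ 2 := by
  rw [dist_graphPoint, dist_graphPoint, Real.sqrt_le_sqrt_iff (by positivity)]

theorem graphPoint_bijective {s : Set ℝ} (g : s → ℝ) : Function.Bijective (graphPoint g) := by
  refine ⟨fun x y hxy => ?_, ?_⟩
  · have h := congrArg (fun q : planeGraph g => (q : EuclideanSpace ℝ (Fin 2)) 0) hxy
    exact Subtype.ext (by simpa [graphPoint] using h)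
  · rintro ⟨_, x, rfl⟩
    exact ⟨x, rfl⟩

theorem continuous_graphPoint {s : Set ℝ} {g : s → ℝ} (hg : Continuous g) :
    Continuous (graphPoint g) := by
  refine Continuous.subtype_mk ((PiLp.continuous_toLp 2 _).comp (continuous_pi fun i => ?_)) _
  fin_cases i
  · exact continuous_subtype_val
  · exact hg

theorem GraphRecedes.hasCMonotoneGraph {s : Set ℝ} {g : s → ℝ} (hg : GraphRecedes g) :
    HasCMonotoneGraph 1 g := by
  let e : s ≃ planeGraph g := Equiv.ofBijective _ (graphPoint_bijective g)
  refine ⟨LinearOrder.lift' e.symm e.symm.injective, fun a b c hab hbc => ?_⟩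
  have h := (dist_graphPoint_le_iff g _ _ _).2 (hg (x := e.symm a) (y := e.symm b) (z := e.symm c)
    hab hbc)
  have he : ∀ a, graphPoint g (e.symm a) = a := e.apply_symm_apply
  rwa [he, he, he, ← one_mul (dist a c)] at h

theorem GraphRecedes.of_monotone {s : Set ℝ} {g : s → ℝ} (hg : Monotone g) : GraphRecedes g := by
  intro x y z hxy hyz
  have h₁ : (x : ℝ) < y := hxy
  have h₂ : (y : ℝ) < z := hyz
  have h₃ := hg hxy.le
  have h₄ := hg hyz.le
  nlinarith

theorem HasCMonotoneGraph.hasMonotoneMajorant {g : Icc (0 : ℝ) 1 → ℝ}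
    (hg : HasCMonotoneGraph 1 g) (hc : Continuous g) : HasMonotoneMajorant g := by
  obtain ⟨_, h⟩ := hg
  simp only [one_mul] at h
  rcases strictMono_or_strictAnti_of_dist_le h (continuous_graphPoint hc)
    (graphPoint_bijective g).1 with hp | hp
  · have hr : GraphRecedes g := fun x y z hxy hyz =>
      (dist_graphPoint_le_iff g x y z).1 (h _ _ _ (hp hxy) (hp hyz))
    exact hr.hasMonotoneMajorant hc
  · have hσ : StrictAnti unitInterval.symm := unitInterval.strictAnti_symm
    have hr : GraphRecedes (g ∘ unitInterval.symm) := fun x y z hxy hyz => by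
      have := (dist_graphPoint_le_iff g _ _ _).1 (h _ _ _ (hp (hσ hxy)) (hp (hσ hyz)))
      simp only [unitInterval.coe_symm_eq] at this
      simp only [Function.comp_apply]
      linarith
    have hm := (hr.hasMonotoneMajorant (hc.comp unitInterval.continuous_symm)).comp_antitone
      hσ.antitone
    simpa [Function.comp_assoc, unitInterval.symm_involutive.comp_self] using hm

/-! ### Continuity of the variation function -/

theorem BoundedVariationOn.continuous_variationOnFromTo {α E : Type*} [LinearOrder α]
    [TopologicalSpace α] [OrderTopology α] [PseudoMetricSpace E] {f : α → E}
    (hf : BoundedVariationOn f univ) (hc : Continuous f) (a : α) :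
    Continuous (variationOnFromTo f univ a) := by
  refine continuous_iff_continuousAt.2 fun x =>
    continuousAt_iff_continuous_left'_right'.2 ⟨?_, ?_⟩
  · have := variationOnFromTo.tendsto_left (l := f x) (mem_univ a) (mem_univ x)
      hf.locallyBoundedVariationOn (hc.continuousAt.mono_left nhdsWithin_le_nhds)
    simpa [ContinuousWithinAt] using this
  · have := variationOnFromTo.tendsto_right (l := f x) (mem_univ a) (mem_univ x)
      hf.locallyBoundedVariationOn (hc.continuousAt.mono_left nhdsWithin_le_nhds)
    simpa [ContinuousWithinAt] using this

theorem mainTheorem8 (f : Set.Icc (0 : ℝ) 1 → ℝ) (hf : Continuous f) :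
    BoundedVariationOn f Set.univ ↔
      ∃ g h : Set.Icc (0 : ℝ) 1 → ℝ,
        Continuous g ∧ Continuous h ∧
        HasCMonotoneGraph 1 g ∧ HasCMonotoneGraph 1 h ∧
        ∀ x, f x = g x + h x := by
  constructor
  · intro hbv
    have hloc := hbv.locallyBoundedVariationOn
    have hv := hbv.continuous_variationOnFromTo hf 0
    have hm : Monotone (variationOnFromTo f univ 0) :=
      monotoneOn_univ.1 (variationOnFromTo.monotoneOn hloc (mem_univ 0))
    have hs : Monotone (variationOnFromTo f univ 0 - f) :=
      monotoneOn_univ.1 (variationOnFromTo.sub_self_monotoneOn hloc (mem_univ 0))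
    exact ⟨variationOnFromTo f univ 0, fun x => -(variationOnFromTo f univ 0 - f) x, hv,
      (hv.sub hf).neg, (GraphRecedes.of_monotone hm).hasCMonotoneGraph,
      (GraphRecedes.of_monotone hs).neg.hasCMonotoneGraph, fun x => by simp⟩
  · rintro ⟨g, h, hg, hh, hgm, hhm, hsum⟩
    rw [funext hsum]
    exact ((hgm.hasMonotoneMajorant hg).add (hhm.hasMonotoneMajorant hh)).boundedVariationOn
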